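/- **Setting.** Two bidders have nonnegative values $v=(v_1,v_2)$ drawn from a possibly correlated prior. A mechanism maps bids to winning probabilities (nonnegative, with sum at most $1$) and payments. It is DSIC if truthful bidding is a dominant strategy at all nonnegative value profiles, and IR if truthful bidders never have negative utility. The revenue $\mathrm{Rev}(M)$ is the expected total payment under truthful bidding, and $\mathrm{OPT}$ is the supremum of $\mathrm{Rev}(M)$ over all DSIC and IR mechanisms $M$. A *lookahead auction with pooling* (LAP) for two bidders raises a cutoff price $c$ from $0$, partly continuously and partly in discrete jumps from some $c^o$ to some $c^+>c^o$ (the intervals $[c^o,c^+)$ are pairwise disjoint), and stops as soon as at least one bidder has a value below $c$. If both bidders drop during a jump $c^o\to c^+$, the item is sold to a uniformly random bidder at price $c^o$. If exactly one bidder survives this jump, she either wins with probability $\frac12$ at price $c^o$, or wins with probability $1$ for the payment $\frac12c^o+\frac12r$, whichever she prefers, where the price $r\ge c^+$ may depend on her identity and on the other bidder's value. If the last competitor drops at $c$ during a continuous phase, the remaining bidder gets a take-it-or-leave-it price $r\ge c$, which may depend on the same data. (The revenue-maximizing posterior prices are one admissible choice of $r$.) A LAP without jumps is a plain lookahead auction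 (LA). **The prior.** Let $0<\varepsilon<\varepsilon_1\le 1$ and $0<\varepsilon_2\le1$ be such that $1$, $1/\varepsilon_1$ and $1/\varepsilon_2$ are integer multiples of $\varepsilon$. Let $v_1$ and $\xi_2$ be independent, where $v_1$ is supported on the multiples of $\varepsilon$ in $[1,1/\varepsilon_1]$ with $\Pr[v_1\ge x]=1/x$ at each support point $x$ (a discretized equal-revenue distribution), and $\xi_2$ has the same form on $[1,1/\varepsilon_2]$. Put $v_2=v_1(\xi_2+\varepsilon^3)$. **Theorem.** The higher value encodes the lower one: always $v_1<v_2$, and the fractional part of $v_2/\varepsilon^2$ is $\varepsilon v_1$. The optimal revenue of this prior is finite and positive. As $\varepsilon_1,\varepsilon_2\to0$, no LAP achieves better than a $\frac12+o(1)$ fraction of it, and pooling gives no asymptotic gain over a plain lookahead auction. That is, for every $\delta>0$ there is $\eta>0$ such that, whenever $\varepsilon_1<\eta$ and $\varepsilon_2<\eta$ (and for every admissible $\varepsilon$), every LAP $A$ satisfies $$\mathrm{Rev}(A)\le\left(\tfrac12+\delta\right)\mathrm{OPT},$$ and there is an LA $L$ such that $\mathrm{Rev}(A)\le(1+\delta)\,\mathrm{Rev}(L)$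 for every LAP $A$. Admissible parameters exist with $\varepsilon_2$, $\varepsilon_1/\varepsilon_2$ and $\varepsilon/\varepsilon_1$ arbitrarily small. -/

import Mathlib

noncomputable section

/-! Truthful single-item auctions -/

/-- A (direct, sealed-bid, randomized) single-item mechanism for `n` bidders: on the bid profile `b`,
bidder `i` receives the item with probability `alloc b i` and pays `pay b i` in expectation. -/
structure Mechanism (n : ℕ) where
  alloc : (Fin n → ℝ) → Fin n → ℝ
  pay : (Fin n → ℝ) → Fin n → ℝ
  alloc_nonneg : ∀ b i, 0 ≤ alloc b i
  alloc_sum_le_one : ∀ b, ∑ i, alloc b i ≤ 1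

/-- Dominant-strategy incentive compatibility, for all nonnegative value profiles `v` and
all nonnegative deviations `b` of a bidder `i`. -/
def Mechanism.DSIC {n : ℕ} (M : Mechanism n) : Prop :=
  ∀ v : Fin n → ℝ, (∀ j, 0 ≤ v j) → ∀ (i : Fin n) (b : ℝ), 0 ≤ b →
    v i * M.alloc (Function.update v i b) i - M.pay (Function.update v i b) i
      ≤ v i * M.alloc v i - M.pay v i

/-- (Ex-post) individual rationality. -/
def Mechanism.IR {n : ℕ} (M : Mechanism n) : Prop :=
  ∀ v : Fin n → ℝ, (∀ j, 0 ≤ v j) → ∀ i : Fin n, 0 ≤ v i * M.alloc v i - M.pay v i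

/-- A finitely supported, possibly correlated, prior on the values of `n` bidders: a random
nonnegative value profile `val` on a finite probability space `Ω`. -/
structure Prior (n : ℕ) where
  Ω : Type
  [fintypeΩ : Fintype Ω]
  prob : Ω → ℝ
  prob_nonneg : ∀ ω, 0 ≤ prob ω
  prob_sum : ∑ ω, prob ω = 1
  val : Ω → Fin n → ℝ
  val_nonneg : ∀ ω i, 0 ≤ val ω i

attribute [instance] Prior.fintypeΩ

/-- Expected revenue of `M` under truthful bidding. -/
def Prior.rev {n : ℕ} (D : Prior n) (M : Mechanism n) : ℝ :=
  ∑ ω, D.prob ω * ∑ i, M.pay (D.val ω) i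

/-- The expected revenues that truthful (DSIC and IR) mechanisms achieve on the prior `D`. -/
def Prior.truthfulRevenues {n : ℕ} (D : Prior n) : Set ℝ :=
  {R | ∃ M : Mechanism n, M.DSIC ∧ M.IR ∧ D.rev M = R}

/-- The optimal revenue. -/
def Prior.opt {n : ℕ} (D : Prior n) : ℝ := sSup D.truthfulRevenues

/-! Lookahead auctions with pooling, for two bidders -/

/-- A lookahead auction with pooling (LAP) for two bidders.  The cutoff price `c` rises from `0`;
it jumps from `J.1` to `J.2` for every `J ∈ jumps`, pooling the values in `[J.1, J.2)`, and rises
continuously elsewhere.  While both bidders are active nothing is known about their values, so this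
schedule is fixed in advance.  `price i w` is the final price for bidder `i` if
`i` is the only survivor and the other bidder, who has dropped, has value `w`; it is at least the
cutoff price at which the auction has stopped.  (Revenue-maximizing posterior prices are one possible
choice; arbitrary prices above the cutoff are allowed.) -/
structure LAP where
  jumps : Set (ℝ × ℝ)
  jump_nonneg : ∀ J ∈ jumps, 0 ≤ J.1
  jump_lt : ∀ J ∈ jumps, J.1 < J.2
  jump_disjoint : jumps.PairwiseDisjoint fun J => Set.Ico J.1 J.2
  price : Fin 2 → ℝ → ℝ
  le_price : ∀ i w, 0 ≤ w → w ≤ price i w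
  le_price_of_jump : ∀ J ∈ jumps, ∀ i, ∀ w ∈ Set.Ico J.1 J.2, J.2 ≤ price i w

open Classical in
/-- The outcome (probability of winning, expected payment) of bidder `i` with bid `u`, when the other
bidder bids `w`.  The auction stops when the cutoff passes `min u w`.
* If this happens in a jump `J = (c, c')`: if both drop, the item goes to either bidder with
probability `1/2` at price `c`.  If only `i` survives, she chooses between winning with
probability `1/2` for an expected payment `c/2`, and winning for sure for the payment
`c/2 + r/2` with `r = price i w`; the second option is the better one iff `r ≤ u`.
* If it happens while the cutoff rises continuously, the survivor gets the take-it-or-leave-it price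
`price i w`; if both drop simultaneously, there is no survivor and the item stays unsold. -/
def LAP.outcome (A : LAP) (i : Fin 2) (u w : ℝ) : ℝ × ℝ :=
  if h : ∃ J ∈ A.jumps, min u w ∈ Set.Ico J.1 J.2 then
    if u < h.choose.2 then
      if w < h.choose.2 then (1 / 2, h.choose.1 / 2) else (0, 0)
    else
      if A.price i w ≤ u then (1, h.choose.1 / 2 + A.price i w / 2)
      else (1 / 2, h.choose.1 / 2)
  else if w < u ∧ A.price i w ≤ u then (1, A.price i w)
  else (0, 0)

theorem LAP.outcome_nonneg (A : LAP) (i : Fin 2) (u w : ℝ) : 0 ≤ (A.outcome i u w).1 := by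
  unfold LAP.outcome
  split_ifs <;> norm_num

theorem LAP.outcome_add_le (A : LAP) (u w : ℝ) :
    (A.outcome 0 u w).1 + (A.outcome 1 w u).1 ≤ 1 := by
  unfold LAP.outcome
  rw [min_comm w u]
  by_cases h : ∃ J ∈ A.jumps, min u w ∈ Set.Ico J.1 J.2
  · have h2 := h.choose_spec.2.2
    rw [min_lt_iff] at h2
    simp only [dif_pos h]
    by_cases hu : u < h.choose.2 <;> by_cases hw : w < h.choose.2
    · simp only [hu, hw, if_true]; norm_num
    · simp only [hu, hw, if_true, if_false]; split_ifs <;> norm_num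
    · simp only [hu, hw, if_true, if_false]; split_ifs <;> norm_num
    · exact absurd h2 (by tauto)
  · simp only [dif_neg h]
    split_ifs with h1 h2 <;> norm_num
    exact absurd h1.1 (not_lt.mpr h2.1.le)

/-- The direct mechanism of a LAP; `i.rev` is the bidder other than `i`. -/
def LAP.toMechanism (A : LAP) : Mechanism 2 where
  alloc b i := (A.outcome i (b i) (b i.rev)).1
  pay b i := (A.outcome i (b i) (b i.rev)).2
  alloc_nonneg _ _ := A.outcome_nonneg _ _ _
  alloc_sum_le_one b := by
    rw [Fin.sum_univ_two]
    exact A.outcome_add_le (b 0) (b 1)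

/-! The correlated prior -/

/-- `Pr[X ≥ k / N]`, for `N ≤ k`, where `X` has the discrete equal-revenue distribution on the
multiples of `1 / N` in `[1, K / N]`: it is `1 / x` at each point `x = k / N` of the support. -/
def erTail (N K k : ℕ) : ℝ := if k ≤ K then (N : ℝ) / k else 0

/-- `Pr[X = k / N]` for this distribution. -/
def erProb (N K k : ℕ) : ℝ := erTail N K k - erTail N K (k + 1)

theorem erProb_nonneg (N K k : ℕ) (hk : 0 < k) : 0 ≤ erProb N K k := by
  have hk' : (0 : ℝ) < k := by exact_mod_cast hk
  unfold erProb erTail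
  split_ifs with h1 h2 h2
  · rw [sub_nonneg]
    exact div_le_div_of_nonneg_left (by positivity) hk' (by push_cast; linarith)
  · rw [sub_zero]; positivity
  · omega
  · simp

/-- The point masses have the stated tails, and in particular add up to `1`. -/
theorem sum_erProb (N K k : ℕ) (hk : k ≤ K) :
    ∑ j ∈ Finset.Icc k K, erProb N K j = (N : ℝ) / k := by
  have h : ∀ m, k ≤ m → ∑ j ∈ Finset.Icc k m, erProb N K j = erTail N K k - erTail N K (m + 1) := by
    intro m hm
    induction m, hm using Nat.le_induction with
    | base => simp [erProb]
    | succ m hm ih =>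
      rw [← Finset.insert_Icc_right_eq_Icc_add_one (by omega),
        Finset.sum_insert (by simp), ih, erProb]
      ring
  rw [h K hk]
  simp [erTail, hk]

/-- Parameters of the construction: the mesh is `ε = 1 / N`, and the endpoints `1 / ε₁ = K₁ / N` and
`1 / ε₂ = K₂ / N` of the two supports are multiples of `ε` that are at least `1`. -/
structure CorrelatedParams where
  N : ℕ
  K₁ : ℕ
  K₂ : ℕ
  N_pos : 0 < N
  le_K₁ : N ≤ K₁
  le_K₂ : N ≤ K₂
  /-- This says `ε < ε₁`. -/
  mesh_lt : (1 : ℝ) / N < N / K₁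

namespace CorrelatedParams

def ε (P : CorrelatedParams) : ℝ := 1 / P.N

def ε₁ (P : CorrelatedParams) : ℝ := P.N / P.K₁

def ε₂ (P : CorrelatedParams) : ℝ := P.N / P.K₂

/-- The prior: `v₁` and `ξ` are independent, with discrete equal-revenue distributions on the
multiples of `ε` in `[1, 1/ε₁]` and `[1, 1/ε₂]`, and `v₂ = v₁ * (ξ + ε ^ 3)`.  A point `(k, l)` of the
probability space stands for `v₁ = k * ε`, `ξ = l * ε`. -/
def prior (P : CorrelatedParams) : Prior 2 where
  Ω := {k : ℕ // k ∈ Finset.Icc P.N P.K₁} × {l : ℕ // l ∈ Finset.Icc P.N P.K₂}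
  prob ω := erProb P.N P.K₁ ω.1 * erProb P.N P.K₂ ω.2
  prob_nonneg ω := by
    have h1 := Finset.mem_Icc.mp ω.1.2
    have h2 := Finset.mem_Icc.mp ω.2.2
    exact mul_nonneg (erProb_nonneg _ _ _ (P.N_pos.trans_le h1.1))
      (erProb_nonneg _ _ _ (P.N_pos.trans_le h2.1))
  prob_sum := by
    have hN : (P.N : ℝ) ≠ 0 := by exact_mod_cast P.N_pos.ne'
    rw [Fintype.sum_prod_type]
    simp only [← Finset.mul_sum]
    rw [← Finset.sum_mul, Finset.sum_coe_sort (Finset.Icc P.N P.K₁) (fun k => erProb P.N P.K₁ k),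
      Finset.sum_coe_sort (Finset.Icc P.N P.K₂) (fun k => erProb P.N P.K₂ k),
      sum_erProb _ _ _ P.le_K₁, sum_erProb _ _ _ P.le_K₂, div_self hN, one_mul]
  val ω := ![ω.1 * P.ε, (ω.1 * P.ε) * (ω.2 * P.ε + P.ε ^ 3)]
  val_nonneg ω i := by
    have hε : 0 ≤ P.ε := div_nonneg zero_le_one (Nat.cast_nonneg _)
    have h1 : (0 : ℝ) ≤ ω.1 * P.ε := mul_nonneg (Nat.cast_nonneg _) hε
    have h2 : (0 : ℝ) ≤ ω.2 * P.ε := mul_nonneg (Nat.cast_nonneg _) hε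
    fin_cases i
    · exact h1
    · exact mul_nonneg h1 (add_nonneg h2 (pow_nonneg hε 3))

end CorrelatedParams

end

/-!
Write `E` for the mean of the lower value `v₁`, which grows like `log (1 / ε₁)`.

*The optimum is about `2 E`.* The second bidder is offered the item for the highest value compatible
with `v₁`, which is about `v₁ / ε₂`; she accepts with probability `ε₂`, and this yields about `E`.
In all other cases the first bidder is offered the item for the price `v₁`, which is read off from
the bid of the second one, and this yields `(1 - ε₂) E` (`le_rev_decodingMechanism`). Both prices
depend only on the bid of the other bidder, so the mechanism is truthful.

*Lookahead auctions get about `E`.* Without pooling, only the higher bidder can win, at a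
price that depends on `v₁` alone. Given `v₁`, her value is `v₁` times an equal-revenue variable, so
no price yields more than about `v₁` (`mul_condTail_le`), and the price `v₁ (1 + ε ^ 3)` yields
at least `v₁` (`meanLow_le_rev_lookahead`).

*Pooling does not help.* Suppose that `v₁` is pooled by a jump from `c` to `c'`. The second bidder
survives it with probability about `v₁ / c'`, in which case half of the item is sold for `c / 2` and
the other half is posted at a price, which yields about `v₁ / 2` on average; if she drops as well,
the item is sold for `c`. In total the revenue is at most about `c (1 - v₁ / (2 c')) + v₁ / 2`
(`condRev_le_of_mem_jump`). For a single `v₁` this can exceed `v₁`, but not on average over the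
jump: summing against the equal-revenue distribution of `v₁`, the claim becomes
`2 (t - 1) / (t + 1) ≤ log t` for `t = c' / c`, or in the discrete setting the inequality between
the arithmetic and the harmonic mean (`two_mul_sub_le_sum_inv`, `sum_jump_le`). Up to factors
`1 + O(ε)`, only the jump that contains the atom at the top of the support of `v₁` may
gain, and it gains at most `1`, which is negligible as `E → ∞` (`rev_LAP_le`, `log_le_meanLow`).
-/

/-! ### The equal-revenue distribution and the prior -/

open Finset in
theorem CorrelatedParams.rev_eq_sum (P : CorrelatedParams) (M : Mechanism 2) :
    P.prior.rev M = ∑ k ∈ Icc P.N P.K₁, erProb P.N P.K₁ k * ∑ l ∈ Icc P.N P.K₂,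
      erProb P.N P.K₂ l *
        ∑ i, M.pay ![(k : ℝ) * P.ε, (k * P.ε) * (l * P.ε + P.ε ^ 3)] i := by
  rw [← Finset.sum_coe_sort (Icc P.N P.K₁)]
  simp_rw [← Finset.sum_coe_sort (Icc P.N P.K₂)]
  change ∑ ω : {k : ℕ // k ∈ Icc P.N P.K₁} × {l : ℕ // l ∈ Icc P.N P.K₂},
    (erProb P.N P.K₁ ω.1 * erProb P.N P.K₂ ω.2) * _ = _
  rw [Fintype.sum_prod_type]
  refine Finset.sum_congr rfl fun k _ => ?_
  rw [Finset.mul_sum]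
  refine Finset.sum_congr rfl fun l _ => ?_
  rw [mul_assoc]
  rfl

theorem sum_Ico_erProb {N K a b : ℕ} (hab : a ≤ b) (hb : b ≤ K) :
    ∑ k ∈ Finset.Ico a b, erProb N K k = (N : ℝ) / a - N / b := by
  have h := Finset.sum_union (f := erProb N K)
    (s₁ := Finset.Ico a b) (s₂ := Finset.Icc b K) (by
      rw [Finset.disjoint_left]; intro x; simp only [Finset.mem_Ico, Finset.mem_Icc]; omega)
  have h2 : Finset.Ico a b ∪ Finset.Icc b K = Finset.Icc a K := by
    ext x; simp only [Finset.mem_union, Finset.mem_Ico, Finset.mem_Icc]; omega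
  rw [h2, sum_erProb _ _ _ (hab.trans hb), sum_erProb _ _ _ hb] at h
  linarith

theorem erProb_mul_of_lt {N K k : ℕ} (hN : 0 < N) (hk : 0 < k) (hK : k < K) :
    erProb N K k * (k * (1 / N)) = 1 / ((k : ℝ) + 1) := by
  have : (0 : ℝ) < N := by exact_mod_cast hN
  have : (0 : ℝ) < k := by exact_mod_cast hk
  rw [erProb, erTail, erTail, if_pos hK.le, if_pos (by omega)]
  push_cast
  field_simp
  ring

theorem erProb_self {N K : ℕ} : erProb N K K = (N : ℝ) / K := by
  simp [erProb, erTail]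

/-- The inequality between the arithmetic and the harmonic mean of `a + 1, …, b`. -/
theorem two_mul_sub_le_sum_inv {a b : ℕ} (hab : a ≤ b) :
    2 * ((b : ℝ) - a) ≤ (∑ k ∈ Finset.Ico a b, 1 / ((k : ℝ) + 1)) * (a + b + 1) := by
  have key : ∀ k ∈ Finset.Ico a b,
      (4 * (a + b + 1) - 4 * ((k : ℝ) + 1)) / (a + b + 1) ^ 2 ≤ 1 / ((k : ℝ) + 1) := by
    intro k _
    rw [div_le_div_iff₀ (by positivity) (by positivity)]
    -- the tangent to the convex function `x ↦ 1 / x` at the arithmetic mean `(a + b + 1) / 2`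
    nlinarith [sq_nonneg ((a : ℝ) + b + 1 - 2 * (k + 1))]
  have hs : ∀ m, a ≤ m → ∑ k ∈ Finset.Ico a m, ((k : ℝ) + 1) = (m - a) * (a + m + 1) / 2 := by
    intro m hm
    induction m, hm using Nat.le_induction with
    | base => simp
    | succ m hm ih => rw [Finset.sum_Ico_succ_top hm, ih]; push_cast; ring
  have h := Finset.sum_le_sum key
  rw [← Finset.sum_div, Finset.sum_sub_distrib, ← Finset.mul_sum, ← Finset.mul_sum, hs b hab,
    Finset.sum_const, Nat.card_Ico, nsmul_eq_mul, Nat.cast_sub hab] at h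
  rw [div_le_iff₀ (by positivity)] at h
  have hpos : (0 : ℝ) < a + b + 1 := by positivity
  have : (2 * ((b : ℝ) - a)) * (a + b + 1) ≤
      ((∑ k ∈ Finset.Ico a b, 1 / ((k : ℝ) + 1)) * (a + b + 1)) * (a + b + 1) := by
    linarith
  exact le_of_mul_le_mul_right this hpos

namespace CorrelatedParams

variable (P : CorrelatedParams)

theorem N_pos' : (0 : ℝ) < P.N := by exact_mod_cast P.N_pos

theorem ε_pos : 0 < P.ε := div_pos one_pos P.N_pos'

theorem ε_le_one : P.ε ≤ 1 := by
  rw [ε, div_le_one P.N_pos']; exact_mod_cast P.N_pos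

theorem ε_mul_N : P.ε * P.N = 1 := by rw [ε, one_div, inv_mul_cancel₀ P.N_pos'.ne']

theorem ε_pow_three_le : P.ε ^ 3 ≤ P.ε :=
  pow_le_of_le_one P.ε_pos.le P.ε_le_one (by norm_num)

/-- The mean of the lower value `v₁`. -/
noncomputable def meanLow : ℝ := ∑ k ∈ Finset.Icc P.N P.K₁, erProb P.N P.K₁ k * (k * P.ε)

theorem prob₁_nonneg {k : ℕ} (hk : k ∈ Finset.Icc P.N P.K₁) : 0 ≤ erProb P.N P.K₁ k :=
  erProb_nonneg _ _ _ (P.N_pos.trans_le (Finset.mem_Icc.mp hk).1)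

theorem prob₂_nonneg {l : ℕ} (hl : l ∈ Finset.Icc P.N P.K₂) : 0 ≤ erProb P.N P.K₂ l :=
  erProb_nonneg _ _ _ (P.N_pos.trans_le (Finset.mem_Icc.mp hl).1)

theorem sum_prob₂ : ∑ l ∈ Finset.Icc P.N P.K₂, erProb P.N P.K₂ l = 1 := by
  rw [sum_erProb _ _ _ P.le_K₂, div_self P.N_pos'.ne']

theorem meanLow_eq :
    P.meanLow = ∑ k ∈ Finset.Ico P.N P.K₁, 1 / ((k : ℝ) + 1) + 1 := by
  have hN := P.N_pos'
  have hK : (0 : ℝ) < P.K₁ := by exact_mod_cast P.N_pos.trans_le P.le_K₁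
  rw [meanLow, ← Finset.Ico_insert_right P.le_K₁, Finset.sum_insert (by simp), add_comm]
  congr 1
  · refine Finset.sum_congr rfl fun k hk => ?_
    rw [Finset.mem_Ico] at hk
    exact erProb_mul_of_lt P.N_pos (P.N_pos.trans_le hk.1) hk.2
  · rw [erProb_self, ε]; field_simp

theorem meanLow_pos : 0 < P.meanLow := by
  rw [meanLow_eq]
  have : 0 ≤ ∑ k ∈ Finset.Ico P.N P.K₁, 1 / ((k : ℝ) + 1) :=
    Finset.sum_nonneg fun k _ => by positivity
  linarith

/-- The mean of the lower value diverges as `ε₁ → 0`. -/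
theorem log_le_meanLow : Real.log (1 / (2 * P.ε₁)) ≤ P.meanLow := by
  have hN := P.N_pos'
  have hN1 : (1 : ℝ) ≤ P.N := by exact_mod_cast P.N_pos
  have hK : (0 : ℝ) < P.K₁ := by exact_mod_cast P.N_pos.trans_le P.le_K₁
  have h : ∀ m, P.N ≤ m → Real.log (((m : ℝ) + 1) / (P.N + 1)) ≤
      ∑ k ∈ Finset.Ico P.N m, 1 / ((k : ℝ) + 1) := by
    intro m hm
    induction m, hm using Nat.le_induction with
    | base => simp [div_self (by positivity : (P.N : ℝ) + 1 ≠ 0)]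
    | succ m hm ih =>
      rw [Finset.sum_Ico_succ_top hm]
      have h1 : (((m + 1 : ℕ) : ℝ) + 1) / (P.N + 1) =
          (((m : ℝ) + 1) / (P.N + 1)) * (1 + 1 / ((m : ℝ) + 1)) := by
        push_cast; field_simp; try ring
      rw [h1, Real.log_mul (by positivity) (by positivity)]
      have h2 := Real.log_le_sub_one_of_pos (show (0 : ℝ) < 1 + 1 / ((m : ℝ) + 1) by positivity)
      linarith
  rw [meanLow_eq]
  refine le_trans (Real.log_le_log ?_ ?_) ((h P.K₁ P.le_K₁).trans (by linarith))
  · have : 0 < P.ε₁ := div_pos hN hK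
    positivity
  · rw [ε₁, div_le_div_iff₀ (by positivity) (by positivity)]
    field_simp
    nlinarith

theorem K₁_lt : P.K₁ < P.N ^ 2 := by
  have hN := P.N_pos'
  have hK : (0 : ℝ) < P.K₁ := by exact_mod_cast P.N_pos.trans_le P.le_K₁
  have h := P.mesh_lt
  rw [div_lt_div_iff₀ hN hK] at h
  have : (P.K₁ : ℝ) < (P.N : ℝ) ^ 2 := by nlinarith
  exact_mod_cast this

theorem fract_encoding {k : ℕ} (hk : k ≤ P.K₁) (l : ℕ) :
    Int.fract (k * P.ε * (l * P.ε + P.ε ^ 3) / P.ε ^ 2) = P.ε * (k * P.ε) := by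
  have hε := P.ε_pos
  have hN := P.N_pos'
  have h1 : k * P.ε * (l * P.ε + P.ε ^ 3) / P.ε ^ 2 = ((k * l : ℕ) : ℝ) + P.ε * (k * P.ε) := by
    push_cast; field_simp
  have h2 : (k : ℝ) < (P.N : ℝ) ^ 2 := by exact_mod_cast hk.trans_lt P.K₁_lt
  rw [h1, Int.fract_natCast_add, Int.fract_eq_self]
  refine ⟨by positivity, ?_⟩
  calc P.ε * (k * P.ε) = k * P.ε ^ 2 := by ring
    _ < P.N ^ 2 * P.ε ^ 2 := by gcongr
    _ = 1 := by rw [← mul_pow, mul_comm, P.ε_mul_N, one_pow]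

theorem low_lt_high {k l : ℕ} (hk : P.N ≤ k) (hl : P.N ≤ l) :
    k * P.ε < k * P.ε * (l * P.ε + P.ε ^ 3) := by
  have hε := P.ε_pos
  have hk' : (0 : ℝ) < k := by exact_mod_cast P.N_pos.trans_le hk
  have hl' : (P.N : ℝ) ≤ l := by exact_mod_cast hl
  have h1 : 1 ≤ l * P.ε := by
    rw [← P.ε_mul_N, mul_comm]; gcongr
  have : 0 < P.ε ^ 3 := by positivity
  exact lt_mul_of_one_lt_right (by positivity) (by linarith)

/-! ### Optimal revenue -/

/-- The largest ratio of the two values. -/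
noncomputable def maxRatio : ℝ := P.K₂ * P.ε + P.ε ^ 3

theorem maxRatio_pos : 0 < P.maxRatio := by
  have := P.ε_pos
  unfold maxRatio
  positivity

/-- The lower value that is encoded in the higher value `y`. -/
noncomputable def decode (y : ℝ) : ℝ := Int.fract (y / P.ε ^ 2) / P.ε

open Classical in
/-- Bidder `1` is offered the item for the highest value that is compatible with the bid of bidder
`0`. If she is bound to refuse, then bidder `0` is offered it for the value that the bid of bidder
`1` encodes. -/
noncomputable def decodingMechanism : Mechanism 2 where
  alloc b := ![if b 1 < P.maxRatio * P.decode (b 1) ∧ P.decode (b 1) ≤ b 0 then 1 else 0,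
    if P.maxRatio * b 0 ≤ b 1 then 1 else 0]
  pay b := ![if b 1 < P.maxRatio * P.decode (b 1) ∧ P.decode (b 1) ≤ b 0
      then P.decode (b 1) else 0,
    if P.maxRatio * b 0 ≤ b 1 then P.maxRatio * b 0 else 0]
  alloc_nonneg b i := by
    fin_cases i
    · simp only [Fin.zero_eta, Matrix.cons_val_zero]; split_ifs <;> norm_num
    · simp only [Fin.mk_one, Matrix.cons_val_one]; split_ifs <;> norm_num
  alloc_sum_le_one b := by
    simp only [Fin.sum_univ_two, Matrix.cons_val_zero, Matrix.cons_val_one]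
    split_ifs with h1 h2 <;> norm_num
    have := mul_le_mul_of_nonneg_left h1.2 P.maxRatio_pos.le
    linarith [h1.1]

theorem decodingMechanism_DSIC : P.decodingMechanism.DSIC := by
  intro v _ i b _
  fin_cases i
  · simp only [decodingMechanism, Fin.zero_eta, Matrix.cons_val_zero, Function.update_self, ne_eq,
      one_ne_zero, not_false_eq_true, Function.update_of_ne]
    split_ifs with h1 h2 h2 <;> grind
  · simp only [decodingMechanism, Fin.mk_one, Matrix.cons_val_one, Matrix.cons_val_fin_one,
      Function.update_self, ne_eq,
      zero_ne_one, not_false_eq_true, Function.update_of_ne]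
    split_ifs with h1 h2 h2 <;> grind

theorem decodingMechanism_IR : P.decodingMechanism.IR := by
  intro v _ i
  fin_cases i
  · simp only [decodingMechanism, Fin.zero_eta, Matrix.cons_val_zero]
    split_ifs with h1 <;> grind
  · simp only [decodingMechanism, Fin.mk_one, Matrix.cons_val_one, Matrix.cons_val_fin_one]
    split_ifs with h1 <;> grind

open Classical in
theorem sum_pay_decodingMechanism (x y : ℝ) :
    ∑ i, P.decodingMechanism.pay ![x, y] i =
      (if y < P.maxRatio * P.decode y ∧ P.decode y ≤ x then P.decode y else 0) +
        if P.maxRatio * x ≤ y then P.maxRatio * x else 0 := by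
  rw [Fin.sum_univ_two]
  rfl

theorem le_rev_decodingMechanism :
    (2 - P.ε₂) * P.meanLow ≤ P.prior.rev P.decodingMechanism := by
  have hε := P.ε_pos
  have hN := P.N_pos'
  have hK : (0 : ℝ) < P.K₂ := by exact_mod_cast P.N_pos.trans_le P.le_K₂
  have hg := P.maxRatio_pos
  rw [rev_eq_sum, meanLow, Finset.mul_sum]
  refine Finset.sum_le_sum fun k hk => ?_
  rw [mul_left_comm]
  refine mul_le_mul_of_nonneg_left ?_ (P.prob₁_nonneg hk)
  rw [Finset.mem_Icc] at hk
  have hw : 0 < k * P.ε := by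
    have : (0 : ℝ) < k := by exact_mod_cast P.N_pos.trans_le hk.1
    positivity
  have hdec : ∀ l : ℕ, P.decode (k * P.ε * (l * P.ε + P.ε ^ 3)) = k * P.ε := by
    intro l
    rw [decode, P.fract_encoding hk.2, mul_div_assoc, mul_div_cancel₀ _ hε.ne']
  have hlast : ∑ i, P.decodingMechanism.pay
      ![k * P.ε, k * P.ε * (P.K₂ * P.ε + P.ε ^ 3)] i = P.maxRatio * (k * P.ε) := by
    rw [sum_pay_decodingMechanism, hdec]
    rw [if_neg, if_pos, zero_add]
    · rw [maxRatio]; linarith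
    · rw [maxRatio]; intro h; linarith [h.1]
  have hrest : ∀ l ∈ Finset.Ico P.N P.K₂, ∑ i, P.decodingMechanism.pay
      ![k * P.ε, k * P.ε * (l * P.ε + P.ε ^ 3)] i = k * P.ε := by
    intro l hl
    have hl' : (l : ℝ) < P.K₂ := by exact_mod_cast (Finset.mem_Ico.mp hl).2
    have h : k * P.ε * (l * P.ε + P.ε ^ 3) < P.maxRatio * (k * P.ε) := by
      rw [maxRatio, mul_comm]; gcongr
    rw [sum_pay_decodingMechanism, hdec]
    rw [if_neg h.not_ge, if_pos ⟨h, le_rfl⟩, add_zero]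
  rw [← Finset.Ico_insert_right P.le_K₂, Finset.sum_insert (by simp), hlast,
    Finset.sum_congr rfl fun l hl => by rw [hrest l hl], ← Finset.sum_mul,
    sum_Ico_erProb P.le_K₂ le_rfl, erProb_self, div_self hN.ne', maxRatio, ← ε₂, ← mul_assoc P.ε₂,
    ← add_mul]
  refine mul_le_mul_of_nonneg_right ?_ hw.le
  have h1 : P.ε₂ * (P.K₂ * P.ε) = 1 := by rw [ε₂, ε]; field_simp
  have h2 : 0 ≤ P.ε₂ * P.ε ^ 3 := mul_nonneg (div_nonneg hN.le hK.le) (by positivity)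
  rw [mul_add, h1]
  linarith

end CorrelatedParams

theorem Prior.bddAbove_truthfulRevenues {n : ℕ} (D : Prior n) : BddAbove D.truthfulRevenues := by
  refine ⟨∑ ω, D.prob ω * ∑ i, D.val ω i, ?_⟩
  rintro R ⟨M, _, hIR, rfl⟩
  refine Finset.sum_le_sum fun ω _ => mul_le_mul_of_nonneg_left
    (Finset.sum_le_sum fun i _ => ?_) (D.prob_nonneg ω)
  have h1 := hIR (D.val ω) (D.val_nonneg ω) i
  have h2 : M.alloc (D.val ω) i ≤ 1 :=
    (Finset.single_le_sum (fun j _ => M.alloc_nonneg (D.val ω) j) (Finset.mem_univ i)).trans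
      (M.alloc_sum_le_one _)
  nlinarith [D.val_nonneg ω i]

theorem CorrelatedParams.isLUB_opt (P : CorrelatedParams) :
    IsLUB P.prior.truthfulRevenues P.prior.opt :=
  isLUB_csSup ⟨_, P.decodingMechanism, P.decodingMechanism_DSIC, P.decodingMechanism_IR, rfl⟩
    P.prior.bddAbove_truthfulRevenues

theorem CorrelatedParams.le_opt (P : CorrelatedParams) :
    (2 - P.ε₂) * P.meanLow ≤ P.prior.opt :=
  P.le_rev_decodingMechanism.trans (P.isLUB_opt.1
    ⟨P.decodingMechanism, P.decodingMechanism_DSIC, P.decodingMechanism_IR, rfl⟩)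

theorem CorrelatedParams.ε₂_le_one (P : CorrelatedParams) : P.ε₂ ≤ 1 :=
  div_le_one_of_le₀ (by exact_mod_cast P.le_K₂) (Nat.cast_nonneg _)

theorem CorrelatedParams.opt_pos (P : CorrelatedParams) : 0 < P.prior.opt :=
  (mul_pos (by linarith [P.ε₂_le_one]) P.meanLow_pos).trans_le P.le_opt

/-! ### Revenue of a LAP, given the lower value -/

/-- Disjointness of the jumps makes the choice of a jump in `LAP.outcome` immaterial. -/
theorem LAP.outcome_of_mem_jump (A : LAP) {J : ℝ × ℝ} (hJ : J ∈ A.jumps) (i : Fin 2) {u w : ℝ}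
    (h : min u w ∈ Set.Ico J.1 J.2) :
    A.outcome i u w =
      if u < J.2 then
        if w < J.2 then (1 / 2, J.1 / 2) else (0, 0)
      else
        if A.price i w ≤ u then (1, J.1 / 2 + A.price i w / 2)
        else (1 / 2, J.1 / 2) := by
  have hex : ∃ J ∈ A.jumps, min u w ∈ Set.Ico J.1 J.2 := ⟨J, hJ, h⟩
  have heq : hex.choose = J := by
    by_contra hne
    exact Set.disjoint_left.mp (A.jump_disjoint hex.choose_spec.1 hJ hne) hex.choose_spec.2 h
  rw [LAP.outcome, dif_pos hex, heq]

/-- The revenue of a LAP if the lower value `w` is pooled by the jump `J`. -/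
theorem LAP.sum_pay_of_mem_jump (A : LAP) {J : ℝ × ℝ} (hJ : J ∈ A.jumps) {w v : ℝ} (hwv : w < v)
    (hw : w ∈ Set.Ico J.1 J.2) :
    ∑ i, A.toMechanism.pay ![w, v] i =
      if v < J.2 then J.1 else J.1 / 2 + if A.price 1 w ≤ v then A.price 1 w / 2 else 0 := by
  have h : ∑ i, A.toMechanism.pay ![w, v] i = (A.outcome 0 w v).2 + (A.outcome 1 v w).2 := by
    rw [Fin.sum_univ_two]; rfl
  rw [h, A.outcome_of_mem_jump hJ 0 (by rwa [min_eq_left hwv.le]),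
    A.outcome_of_mem_jump hJ 1 (by rwa [min_eq_right hwv.le]), if_pos hw.2, if_pos hw.2]
  split_ifs <;> simp

/-- The revenue of a LAP if it stops at the lower value `w` while the cutoff rises continuously. -/
theorem LAP.sum_pay_of_not_mem_jump (A : LAP) {w v : ℝ} (hwv : w < v)
    (hw : ∀ J ∈ A.jumps, w ∉ Set.Ico J.1 J.2) :
    ∑ i, A.toMechanism.pay ![w, v] i = if A.price 1 w ≤ v then A.price 1 w else 0 := by
  have h : ∑ i, A.toMechanism.pay ![w, v] i = (A.outcome 0 w v).2 + (A.outcome 1 v w).2 := by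
    rw [Fin.sum_univ_two]; rfl
  rw [h, LAP.outcome, LAP.outcome, min_eq_left hwv.le, min_eq_right hwv.le, dif_neg, dif_neg,
    if_neg (by simp [hwv.le])]
  · simp only [hwv, true_and, zero_add]
    split_ifs <;> rfl
  all_goals push Not; exact hw

namespace CorrelatedParams

variable (P : CorrelatedParams)

/-- The probability that `w (ξ + ε ^ 3)` is at least `r`: that the higher value is at least `r` if
the lower one is `w`. -/
noncomputable def condTail (w r : ℝ) : ℝ :=
  ∑ l ∈ Finset.Icc P.N P.K₂,
    erProb P.N P.K₂ l * if r ≤ w * (l * P.ε + P.ε ^ 3) then 1 else 0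

theorem condTail_nonneg (w r : ℝ) : 0 ≤ P.condTail w r :=
  Finset.sum_nonneg fun l hl => mul_nonneg (P.prob₂_nonneg hl) (by split_ifs <;> norm_num)

/-- Either the tail vanishes, or it is the tail of `ξ` at the least support point `l ε` at which
the higher value reaches `r`. -/
theorem condTail_eq {w : ℝ} (hw : 0 ≤ w) (r : ℝ) :
    P.condTail w r = 0 ∨
    ∃ l : ℕ, P.N ≤ l ∧ r ≤ w * (l * P.ε + P.ε ^ 3) ∧
      (P.N < l → w * ((l - 1) * P.ε + P.ε ^ 3) < r) ∧ P.condTail w r = P.N / l := by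
  by_cases h : ∃ l : ℕ, P.N ≤ l ∧ l ≤ P.K₂ ∧ r ≤ w * (l * P.ε + P.ε ^ 3)
  · right
    classical
    obtain ⟨h1, h2, h3⟩ := Nat.find_spec h
    refine ⟨Nat.find h, h1, h3, fun hlt => ?_, ?_⟩
    · have hm := Nat.find_min h (m := Nat.find h - 1) (by omega)
      push Not at hm
      have := hm (by omega) (by omega)
      rwa [Nat.cast_sub (by omega), Nat.cast_one] at this
    · rw [← sum_erProb P.N P.K₂ _ h2, condTail,
        ← Finset.sum_subset (Finset.Icc_subset_Icc_left h1)]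
      · refine Finset.sum_congr rfl fun l hl => ?_
        have hl' : ((Nat.find h : ℕ) : ℝ) ≤ l := by exact_mod_cast (Finset.mem_Icc.mp hl).1
        have := P.ε_pos
        rw [if_pos, mul_one]
        exact h3.trans (by gcongr)
      · intro l hl hl'
        rw [Finset.mem_Icc] at hl hl'
        rw [if_neg, mul_zero]
        intro hr
        exact hl' ⟨Nat.find_min' h ⟨hl.1, hl.2, hr⟩, hl.2⟩
  · left
    push Not at h
    refine Finset.sum_eq_zero fun l hl => ?_
    rw [Finset.mem_Icc] at hl
    rw [if_neg (h l hl.1 hl.2).not_ge, mul_zero]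

/-- Given the lower value `w`, no posted price yields more than about `w`: this is the defining
property of an equal-revenue distribution. -/
theorem mul_condTail_le {w : ℝ} (hw : 0 ≤ w) (r : ℝ) :
    r * P.condTail w r ≤ w * (1 + P.ε ^ 3) := by
  have hε := P.ε_pos
  rcases P.condTail_eq hw r with h | ⟨l, hl, hr, -, h⟩
  · rw [h, mul_zero]; positivity
  · have hN := P.N_pos'
    have hl' : (P.N : ℝ) ≤ l := by exact_mod_cast hl
    have hl0 : (0 : ℝ) < l := hN.trans_le hl'
    rw [h, ← mul_div_assoc, div_le_iff₀ hl0]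
    have h1 : P.ε * P.N = 1 := P.ε_mul_N
    calc r * P.N ≤ w * (l * P.ε + P.ε ^ 3) * P.N := by gcongr
      _ = w * (l * (P.ε * P.N) + P.ε ^ 3 * P.N) := by ring
      _ ≤ w * (l * (P.ε * P.N) + P.ε ^ 3 * l) := by gcongr
      _ = w * (1 + P.ε ^ 3) * l := by rw [h1]; ring

theorem le_condTail {w c : ℝ} (hw : 0 ≤ w) (hwc : w ≤ c) (h0 : P.condTail w c ≠ 0) :
    w ≤ P.condTail w c * (c * (1 + P.ε)) := by
  have hε := P.ε_pos
  have hN := P.N_pos'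
  rcases P.condTail_eq hw c with h | ⟨l, hl, -, hmin, h⟩
  · exact absurd h h0
  rw [h]
  have hc : 0 ≤ c := hw.trans hwc
  rcases hl.eq_or_lt with rfl | hlt
  · rw [div_self hN.ne', one_mul]
    nlinarith
  · have hl0 : (0 : ℝ) < l := by exact_mod_cast P.N_pos.trans hlt
    have h2 := hmin hlt
    have h3 : 0 ≤ w * P.ε ^ 3 := by positivity
    have h1 : P.ε * P.N = 1 := P.ε_mul_N
    have h4 : w * (l * P.ε) ≤ c * (1 + P.ε) := by nlinarith
    rw [div_mul_eq_mul_div, le_div_iff₀ hl0]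
    calc w * l = w * (l * P.ε) * P.N := by rw [mul_assoc, mul_assoc, h1, mul_one]
      _ ≤ c * (1 + P.ε) * P.N := by gcongr
      _ = _ := by ring

/-- The expected revenue of a LAP, given the lower value `k ε`. -/
noncomputable def condRev (A : LAP) (k : ℕ) : ℝ :=
  ∑ l ∈ Finset.Icc P.N P.K₂, erProb P.N P.K₂ l *
    ∑ i, A.toMechanism.pay ![(k : ℝ) * P.ε, (k * P.ε) * (l * P.ε + P.ε ^ 3)] i

theorem condRev_le_of_not_mem_jump (A : LAP) {k : ℕ} (hk : P.N ≤ k)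
    (h : ∀ J ∈ A.jumps, k * P.ε ∉ Set.Ico J.1 J.2) :
    P.condRev A k ≤ k * P.ε * (1 + P.ε ^ 3) := by
  have hε := P.ε_pos
  have hw : 0 ≤ k * P.ε := by positivity
  refine le_trans (le_of_eq ?_) (P.mul_condTail_le hw (A.price 1 (k * P.ε)))
  rw [condRev, condTail, Finset.mul_sum]
  refine Finset.sum_congr rfl fun l hl => ?_
  rw [A.sum_pay_of_not_mem_jump (P.low_lt_high hk (Finset.mem_Icc.mp hl).1) h]
  split_ifs <;> ring

/-- A bidder who survives the jump from `c` to `c'` pays only half of `c` for half of the item, and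
she survives with probability about `w / c'` given the lower value `w`. The other half of the item
is posted at a price, which yields about `w / 2`. -/
theorem condRev_le_of_mem_jump (A : LAP) {J : ℝ × ℝ} (hJ : J ∈ A.jumps) {k : ℕ} (hk : P.N ≤ k)
    (h : k * P.ε ∈ Set.Ico J.1 J.2) :
    P.condRev A k ≤ J.1 * (1 - k * P.ε / (2 * (J.2 * (1 + P.ε)))) +
      k * P.ε / 2 * (1 + P.ε ^ 3) := by
  have hε := P.ε_pos
  have hk0 : (0 : ℝ) < k := by exact_mod_cast P.N_pos.trans_le hk
  have hw : 0 < k * P.ε := by positivity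
  have hc := A.jump_nonneg J hJ
  have hc' : 0 < J.2 := hw.trans h.2
  set w := k * P.ε with hwdef
  set r := A.price 1 w with hr
  have hrc : J.2 ≤ r := A.le_price_of_jump J hJ 1 w h
  have heq : P.condRev A k = J.1 * (1 - P.condTail w J.2 / 2) + r * P.condTail w r / 2 := by
    have hone := P.sum_prob₂
    rw [← hone, condTail, condTail, Finset.mul_sum, Finset.sum_div, Finset.sum_div,
      ← Finset.sum_sub_distrib, Finset.mul_sum, ← Finset.sum_add_distrib, condRev]
    refine Finset.sum_congr rfl fun l hl => ?_
    rw [A.sum_pay_of_mem_jump hJ (P.low_lt_high hk (Finset.mem_Icc.mp hl).1) h, ← hwdef, ← hr]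
    by_cases h1 : w * (l * P.ε + P.ε ^ 3) < J.2
    · rw [if_pos h1, if_neg h1.not_ge, if_neg (h1.trans_le hrc).not_ge]; ring
    · rw [if_neg h1, if_pos (not_lt.mp h1)]
      split_ifs <;> ring
  have hpost := P.mul_condTail_le hw.le r
  rw [heq]
  have hD : 0 < J.2 * (1 + P.ε) := by positivity
  by_cases h0 : P.condTail w J.2 = 0
  · -- then nobody buys at `r ≥ c'` either
    have h0' : r * P.condTail w r = 0 := by
      rw [le_antisymm _ (P.condTail_nonneg w r), mul_zero]
      rw [← h0]
      refine Finset.sum_le_sum fun l hl => mul_le_mul_of_nonneg_left ?_ (P.prob₂_nonneg hl)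
      split_ifs with h1 h2
      · exact le_rfl
      · exact absurd (hrc.trans h1) h2
      · norm_num
      · exact le_rfl
    have h1 : J.1 * (w / (2 * (J.2 * (1 + P.ε)))) ≤ w / 2 := by
      rw [mul_div_assoc', div_le_div_iff₀ (by positivity) two_pos]
      have : J.1 ≤ J.2 * (1 + P.ε) := by nlinarith [h.1, h.2]
      nlinarith
    have h2 : 0 ≤ w / 2 * P.ε ^ 3 := by positivity
    rw [h0, h0']
    linarith
  · have h1 := P.le_condTail hw.le h.2.le h0
    have h2 : w / (2 * (J.2 * (1 + P.ε))) ≤ P.condTail w J.2 / 2 := by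
      rw [div_le_div_iff₀ (by positivity) two_pos]
      linarith
    have h3 := mul_le_mul_of_nonneg_left h2 hc
    linarith

/-! ### Pooling gains nothing on average -/

open Finset in
/-- Over a jump that ends within the support, the loss from selling half of the item to the survivor
cheaply outweighs the gain from selling the item if both bidders drop, up to a factor `1 + O(ε)`.
In the continuous limit, this is the inequality `2 (t - 1) / (t + 1) ≤ log t` for `t = c' / c`. -/
theorem sum_jump_le {a b : ℕ} {c c' : ℝ} (hN : P.N ≤ a) (hab : a < b) (hb : b ≤ P.K₁)
    (hc : 0 ≤ c) (hca : c ≤ a * P.ε) (hc' : 0 < c') (hcb : c' ≤ b * P.ε) :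
    ∑ k ∈ Ico a b, erProb P.N P.K₁ k *
        (c * (1 - k * P.ε / (2 * (c' * (1 + P.ε)))) + k * P.ε / 2 * (1 + P.ε ^ 3)) ≤
      (1 + 2 * P.ε) * ∑ k ∈ Ico a b, erProb P.N P.K₁ k * (k * P.ε) := by
  have hε := P.ε_pos
  have hN0 := P.N_pos'
  have hεN := P.ε_mul_N
  have hNa : (P.N : ℝ) ≤ a := by exact_mod_cast hN
  have hab' : (a : ℝ) < b := by exact_mod_cast hab
  have ha0 : (0 : ℝ) < a := hN0.trans_le hNa
  have hb0 : (0 : ℝ) < b := ha0.trans hab'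
  have hε3 := P.ε_pow_three_le
  set H := ∑ k ∈ Ico a b, erProb P.N P.K₁ k * (k * P.ε) with hH
  have hHeq : H = ∑ k ∈ Ico a b, 1 / ((k : ℝ) + 1) := by
    refine Finset.sum_congr rfl fun k hk => ?_
    rw [Finset.mem_Ico] at hk
    exact erProb_mul_of_lt P.N_pos (P.N_pos.trans_le (hN.trans hk.1)) (hk.2.trans_le hb)
  have hH0 : 0 ≤ H := by rw [hHeq]; exact Finset.sum_nonneg fun k _ => by positivity
  have hAMHM : 2 * ((b : ℝ) - a) ≤ H * (a + b + 1) := hHeq ▸ two_mul_sub_le_sum_inv hab.le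
  have hS := sum_Ico_erProb (N := P.N) hab.le hb
  have hsplit : ∑ k ∈ Ico a b, erProb P.N P.K₁ k *
        (c * (1 - k * P.ε / (2 * (c' * (1 + P.ε)))) + k * P.ε / 2 * (1 + P.ε ^ 3)) =
      c * ((P.N : ℝ) / a - P.N / b - H / (2 * (c' * (1 + P.ε)))) + H / 2 * (1 + P.ε ^ 3) := by
    rw [← hS, hH, Finset.sum_div, Finset.sum_div, ← Finset.sum_sub_distrib, Finset.mul_sum,
      Finset.sum_mul, ← Finset.sum_add_distrib]
    refine Finset.sum_congr rfl fun k _ => ?_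
    ring
  rw [hsplit]
  have hfirst : c * ((P.N : ℝ) / a - P.N / b - H / (2 * (c' * (1 + P.ε)))) ≤
      H * (1 / 2 + P.ε) := by
    have h1 : (P.N : ℝ) / a - P.N / b - H / (2 * (c' * (1 + P.ε))) ≤
        (P.N : ℝ) / a - P.N / b - H / (2 * (b * P.ε * (1 + P.ε))) := by
      gcongr
    refine (mul_le_mul_of_nonneg_left h1 hc).trans ?_
    by_cases hneg : (P.N : ℝ) / a - P.N / b - H / (2 * (b * P.ε * (1 + P.ε))) ≤ 0
    · have := mul_nonpos_of_nonneg_of_nonpos hc hneg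
      have : 0 ≤ H * (1 / 2 + P.ε) := by positivity
      linarith
    push Not at hneg
    refine (mul_le_mul_of_nonneg_right hca hneg.le).trans ?_
    have h2 : a * P.ε * ((P.N : ℝ) / a - P.N / b - H / (2 * (b * P.ε * (1 + P.ε)))) =
        ((b - a) * (2 * (1 + P.ε)) - a * H) / (2 * b * (1 + P.ε)) := by
      have : a * P.ε * ((P.N : ℝ) / a - P.N / b) = (P.ε * P.N) * (b - a) / b := by
        field_simp
      rw [mul_sub, this, hεN]
      field_simp
    rw [h2, div_le_iff₀ (by positivity)]
    have h3 : 1 ≤ P.ε * b := by rw [← hεN]; gcongr; linarith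
    have h4 : H ≤ H * (P.ε * b) := le_mul_of_one_le_right hH0 h3
    have h5 : P.ε * (H * a) ≤ P.ε * (H * b) := by gcongr
    have h6 : P.ε * H ≤ P.ε * (H * (P.ε * b)) := by gcongr
    have h7 := mul_le_mul_of_nonneg_left hAMHM (by positivity : 0 ≤ 1 + P.ε)
    nlinarith
  have h1 : H * P.ε ^ 3 ≤ H * P.ε := by gcongr
  have h2 : 0 ≤ H * P.ε := by positivity
  linarith

open Finset in
theorem sum_condRev_jump_le (A : LAP) {J : ℝ × ℝ} (hJ : J ∈ A.jumps) {F : Finset ℕ}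
    (hF : ∀ k, k ∈ F ↔ (P.N ≤ k ∧ k ≤ P.K₁) ∧ k * P.ε ∈ Set.Ico J.1 J.2) :
    ∑ k ∈ F, erProb P.N P.K₁ k * P.condRev A k ≤
      ∑ k ∈ F, ((1 + 2 * P.ε) * (erProb P.N P.K₁ k * (k * P.ε)) +
        if k = P.K₁ then 1 else 0) := by
  have hε := P.ε_pos
  have hε1 := P.ε_le_one
  have hε3 := P.ε_pow_three_le
  have hN0 := P.N_pos'
  have hεN := P.ε_mul_N
  have hc := A.jump_nonneg J hJ
  have hc' : 0 < J.2 := hc.trans_lt (A.jump_lt J hJ)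
  have hprob : ∀ k ∈ F, 0 ≤ erProb P.N P.K₁ k := fun k hk =>
    P.prob₁_nonneg (Finset.mem_Icc.mpr ((hF k).mp hk).1)
  have hle : ∑ k ∈ F, erProb P.N P.K₁ k * P.condRev A k ≤ ∑ k ∈ F, erProb P.N P.K₁ k *
        (J.1 * (1 - k * P.ε / (2 * (J.2 * (1 + P.ε)))) + k * P.ε / 2 * (1 + P.ε ^ 3)) :=
    Finset.sum_le_sum fun k hk => mul_le_mul_of_nonneg_left
      (P.condRev_le_of_mem_jump A hJ ((hF k).mp hk).1.1 ((hF k).mp hk).2) (hprob k hk)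
  refine hle.trans ?_
  set a := max P.N ⌈J.1 * P.N⌉₊
  set b := ⌈J.2 * P.N⌉₊
  have hmul : ∀ x y : ℝ, x ≤ y * P.ε ↔ x * P.N ≤ y := by
    intro x y
    rw [ε, mul_one_div, le_div_iff₀ hN0]
  have hmem : ∀ k, k ∈ F ↔ a ≤ k ∧ k < b ∧ k ≤ P.K₁ := by
    intro k
    rw [hF, Set.mem_Ico, ← not_le, hmul, hmul, not_le, max_le_iff, Nat.ceil_le, Nat.lt_ceil]
    tauto
  have hca : J.1 ≤ a * P.ε := by
    rw [hmul]
    exact (Nat.le_ceil _).trans (by exact_mod_cast le_max_right _ _)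
  have hNa : P.N ≤ a := le_max_left _ _
  have ha0 : (0 : ℝ) < a := hN0.trans_le (by exact_mod_cast hNa)
  rw [Finset.sum_add_distrib, ← Finset.mul_sum]
  by_cases hbK : b ≤ P.K₁
  · have hFeq : F = Ico a b := by
      ext k; rw [hmem, Finset.mem_Ico]; omega
    have hind : 0 ≤ ∑ k ∈ F, if k = P.K₁ then (1 : ℝ) else 0 :=
      Finset.sum_nonneg fun k _ => by split_ifs <;> norm_num
    rcases lt_or_ge a b with hab | hab
    · have := P.sum_jump_le hNa hab hbK hc hca hc' ((hmul _ _).mpr (Nat.le_ceil _))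
      rw [← hFeq] at this
      linarith
    · rw [hFeq, Finset.Ico_eq_empty (by omega)]; simp
  -- otherwise `F`, unless it is empty, contains the atom at the top of the support; the terms in
  -- `J.1` then contribute at most `1`
  · have hFeq : F = Icc a P.K₁ := by
      ext k; rw [hmem, Finset.mem_Icc]; omega
    rcases le_or_gt a P.K₁ with haK | haK
    swap
    · rw [hFeq, Finset.Icc_eq_empty (by omega)]; simp
    have hind : ∑ k ∈ F, (if k = P.K₁ then (1 : ℝ) else 0) = 1 := by
      rw [Finset.sum_ite_eq' F, if_pos]
      rw [hFeq, Finset.mem_Icc]; omega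
    have hsum : ∑ k ∈ F, erProb P.N P.K₁ k * J.1 ≤ 1 := by
      rw [← Finset.sum_mul, hFeq, sum_erProb _ _ _ haK, div_mul_eq_mul_div, div_le_one ha0,
        mul_comm, ← hmul]
      exact hca
    have hpt : ∑ k ∈ F, erProb P.N P.K₁ k *
        (J.1 * (1 - k * P.ε / (2 * (J.2 * (1 + P.ε)))) + k * P.ε / 2 * (1 + P.ε ^ 3)) ≤
        ∑ k ∈ F, (erProb P.N P.K₁ k * J.1 + (1 + 2 * P.ε) * (erProb P.N P.K₁ k * (k * P.ε))) := by
      refine Finset.sum_le_sum fun k hk => ?_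
      have hw : 0 ≤ k * P.ε := by positivity
      have h1 : 0 ≤ J.1 * (k * P.ε / (2 * (J.2 * (1 + P.ε)))) := by positivity
      have h2 : k * P.ε / 2 * (1 + P.ε ^ 3) ≤ k * P.ε * (1 + 2 * P.ε) := by nlinarith
      have := mul_le_mul_of_nonneg_left (show
        J.1 * (1 - k * P.ε / (2 * (J.2 * (1 + P.ε)))) + k * P.ε / 2 * (1 + P.ε ^ 3) ≤
          J.1 + k * P.ε * (1 + 2 * P.ε) by linarith) (hprob k hk)
      linarith
    rw [Finset.sum_add_distrib, ← Finset.mul_sum] at hpt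
    linarith

open Finset Classical in
theorem rev_LAP_le (A : LAP) : P.prior.rev A.toMechanism ≤ (1 + 2 * P.ε) * P.meanLow + 1 := by
  have hε := P.ε_pos
  have hε3 := P.ε_pow_three_le
  have hrhs : (1 + 2 * P.ε) * P.meanLow + 1 = ∑ k ∈ Icc P.N P.K₁,
      ((1 + 2 * P.ε) * (erProb P.N P.K₁ k * (k * P.ε)) + if k = P.K₁ then 1 else 0) := by
    rw [Finset.sum_add_distrib, ← Finset.mul_sum, Finset.sum_ite_eq' (Icc P.N P.K₁), if_pos]
    · rfl
    · rw [Finset.mem_Icc]; exact ⟨P.le_K₁, le_rfl⟩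
  -- the support of the lower value is partitioned by the jump, if any, that pools it
  let g : ℕ → Option (ℝ × ℝ) := fun k =>
    if h : ∃ J ∈ A.jumps, k * P.ε ∈ Set.Ico J.1 J.2 then some h.choose else none
  have hg : ∀ k J, g k = some J ↔ J ∈ A.jumps ∧ k * P.ε ∈ Set.Ico J.1 J.2 := by
    intro k J
    simp only [g]
    split_ifs with h
    · rw [Option.some_inj]
      constructor
      · rintro rfl; exact h.choose_spec
      · intro hJ
        by_contra hne
        exact Set.disjoint_left.mp (A.jump_disjoint h.choose_spec.1 hJ.1 hne) h.choose_spec.2 hJ.2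
    · simp only [false_iff]
      exact fun hJ => h ⟨J, hJ⟩
  have hmaps : ∀ k ∈ Icc P.N P.K₁, g k ∈ (Icc P.N P.K₁).image g :=
    fun k hk => Finset.mem_image_of_mem g hk
  rw [hrhs, rev_eq_sum, ← Finset.sum_fiberwise_of_maps_to hmaps,
    ← Finset.sum_fiberwise_of_maps_to hmaps]
  refine Finset.sum_le_sum fun o ho => ?_
  rcases o with _ | J
  · refine Finset.sum_le_sum fun k hk => ?_
    obtain ⟨hk, hnone⟩ := Finset.mem_filter.mp hk
    have hno : ∀ J ∈ A.jumps, k * P.ε ∉ Set.Ico J.1 J.2 := by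
      intro J hJ hmem
      rw [(hg k J).mpr ⟨hJ, hmem⟩] at hnone
      exact Option.some_ne_none _ hnone
    have h1 := P.condRev_le_of_not_mem_jump A (Finset.mem_Icc.mp hk).1 hno
    have hw : 0 ≤ k * P.ε := by positivity
    have h2 : k * P.ε * (1 + P.ε ^ 3) ≤ k * P.ε * (1 + 2 * P.ε) := by gcongr; linarith
    have h3 := mul_le_mul_of_nonneg_left (h1.trans h2) (P.prob₁_nonneg hk)
    have h4 : (0 : ℝ) ≤ if k = P.K₁ then 1 else 0 := by split_ifs <;> norm_num
    rw [condRev] at h3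
    linarith
  · obtain ⟨k, -, hk⟩ := Finset.mem_image.mp ho
    have hJ := ((hg k J).mp hk).1
    refine P.sum_condRev_jump_le A hJ fun k => ?_
    rw [Finset.mem_filter, Finset.mem_Icc, hg]
    tauto

/-- The lookahead auction that offers the item to the survivor at the least value that is compatible
with the lower one, so that she always buys. -/
noncomputable def lookahead : LAP where
  jumps := ∅
  jump_nonneg := by simp
  jump_lt := by simp
  jump_disjoint := by simp
  price _ w := w * (1 + P.ε ^ 3)
  le_price _ w hw := by
    have := P.ε_pos
    exact le_mul_of_one_le_right hw (by linarith [pow_pos this 3])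
  le_price_of_jump := by simp

theorem meanLow_le_rev_lookahead : P.meanLow ≤ P.prior.rev P.lookahead.toMechanism := by
  have hε := P.ε_pos
  rw [rev_eq_sum, meanLow]
  refine Finset.sum_le_sum fun k hk => mul_le_mul_of_nonneg_left ?_ (P.prob₁_nonneg hk)
  rw [Finset.mem_Icc] at hk
  have hone : k * P.ε = ∑ l ∈ Finset.Icc P.N P.K₂, erProb P.N P.K₂ l * (k * P.ε) := by
    rw [← Finset.sum_mul, P.sum_prob₂, one_mul]
  refine hone.trans_le (Finset.sum_le_sum fun l hl => mul_le_mul_of_nonneg_left ?_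
    (P.prob₂_nonneg hl))
  rw [Finset.mem_Icc] at hl
  have hl' : (P.N : ℝ) ≤ l := by exact_mod_cast hl.1
  have h1 : 1 ≤ l * P.ε := by
    rw [← P.ε_mul_N, mul_comm]; gcongr
  rw [LAP.sum_pay_of_not_mem_jump _ (P.low_lt_high hk.1 hl.1) (by simp [lookahead]), if_pos]
  · exact P.lookahead.le_price 1 _ (by positivity)
  · change k * P.ε * (1 + P.ε ^ 3) ≤ _
    gcongr

/-! ### Choice of parameters -/

theorem exists_separated {η : ℝ} (hη : 0 < η) : ∃ P : CorrelatedParams,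
    P.ε₂ < η ∧ P.ε₁ < η * P.ε₂ ∧ P.ε < η * P.ε₁ := by
  obtain ⟨n, hn⟩ := exists_nat_gt (1 / η)
  obtain ⟨m, hm, hm2⟩ : ∃ m : ℕ, n ≤ m ∧ 2 ≤ m := ⟨max n 2, le_max_left _ _, le_max_right _ _⟩
  have hm0 : (0 : ℝ) < m := by exact_mod_cast (by omega : 0 < m)
  have hm1 : (1 : ℝ) < m := by exact_mod_cast (by omega : 1 < m)
  have hmη : 1 / (m : ℝ) < η := by
    rw [div_lt_comm₀ hm0 hη]
    exact hn.trans_le (by exact_mod_cast hm)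
  have h3 : 0 < m ^ 3 := by positivity
  refine ⟨⟨m ^ 3, m ^ 5, m ^ 4, h3, Nat.pow_le_pow_right (by omega) (by norm_num),
    Nat.pow_le_pow_right (by omega) (by norm_num), ?_⟩, ?_, ?_, ?_⟩
  · push_cast
    rw [div_lt_div_iff₀ (by positivity) (by positivity), one_mul, ← pow_add]
    exact pow_lt_pow_right₀ hm1 (by norm_num)
  all_goals simp only [ε, ε₁, ε₂, Nat.cast_pow]
  · calc (m : ℝ) ^ 3 / m ^ 4 = 1 / m := by field_simp
      _ < η := hmη
  · calc (m : ℝ) ^ 3 / m ^ 5 = 1 / m * (m ^ 3 / m ^ 4) := by field_simp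
      _ < η * (m ^ 3 / m ^ 4) := by gcongr
  · calc (1 : ℝ) / m ^ 3 = 1 / m * (m ^ 3 / m ^ 5) := by field_simp
      _ < η * (m ^ 3 / m ^ 5) := by gcongr

theorem ε_lt_ε₁ : P.ε < P.ε₁ := P.mesh_lt

/-- The mesh and the additive `1` in `rev_LAP_le` vanish in comparison with the mean of the lower
value. -/
theorem rev_LAP_le_of_small {δ : ℝ} (hδ : 0 < δ) (h1 : P.ε₁ < δ / 4)
    (h2 : P.ε₁ < Real.exp (-(2 / δ)) / 2) (A : LAP) :
    P.prior.rev A.toMechanism ≤ (1 + δ) * P.meanLow := by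
  have hE := P.meanLow_pos
  have hε := P.ε_lt_ε₁
  have hε0 : 0 < P.ε₁ := P.ε_pos.trans hε
  have hlog : 2 / δ ≤ P.meanLow := by
    refine le_trans ?_ P.log_le_meanLow
    rw [Real.le_log_iff_exp_le (by positivity), le_div_iff₀ (by positivity)]
    rw [Real.exp_neg, lt_div_iff₀ two_pos, lt_inv_comm₀ (by positivity) (Real.exp_pos _),
      inv_eq_one_div, lt_div_iff₀ (by positivity)] at h2
    linarith
  rw [div_le_iff₀ hδ] at hlog
  have h3 := P.rev_LAP_le A
  have h4 : 2 * P.ε * P.meanLow ≤ δ / 2 * P.meanLow := by gcongr; linarith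
  linarith

end CorrelatedParams

theorem theorem1 :
    -- the parameters can be as small, and as far apart, as desired
    (∀ η : ℝ, 0 < η → ∃ P : CorrelatedParams,
      P.ε₂ < η ∧ P.ε₁ < η * P.ε₂ ∧ P.ε < η * P.ε₁) ∧
    -- the second value is the higher one, and it encodes the lower one
    (∀ (P : CorrelatedParams) (ω : P.prior.Ω),
      P.prior.val ω 0 < P.prior.val ω 1 ∧
      Int.fract (P.prior.val ω 1 / P.ε ^ 2) = P.ε * P.prior.val ω 0) ∧
    -- the optimal revenue is a genuine, positive supremum
    (∀ P : CorrelatedParams,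
      IsLUB P.prior.truthfulRevenues P.prior.opt ∧ 0 < P.prior.opt) ∧
    -- asymptotically, no LAP gets more than half of it, nor more than a plain lookahead auction
    (∀ δ : ℝ, 0 < δ → ∃ η : ℝ, 0 < η ∧ ∀ P : CorrelatedParams, P.ε₁ < η → P.ε₂ < η →
      (∀ A : LAP, P.prior.rev A.toMechanism ≤ (1 / 2 + δ) * P.prior.opt) ∧
      ∃ L : LAP, L.jumps = ∅ ∧
        ∀ A : LAP, P.prior.rev A.toMechanism ≤ (1 + δ) * P.prior.rev L.toMechanism) := by
  refine ⟨fun η hη => CorrelatedParams.exists_separated hη, fun P ω => ?_,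
    fun P => ⟨P.isLUB_opt, P.opt_pos⟩, fun δ hδ => ?_⟩
  · have h1 := Finset.mem_Icc.mp ω.1.2
    have h2 := Finset.mem_Icc.mp ω.2.2
    exact ⟨P.low_lt_high h1.1 h2.1, P.fract_encoding h1.2 _⟩
  · refine ⟨min (min (δ / 4) (Real.exp (-(2 / δ)) / 2)) (δ / (1 / 2 + δ)), by positivity,
      fun P h1 h2 => ?_⟩
    rw [lt_min_iff, lt_min_iff] at h1 h2
    have hA := P.rev_LAP_le_of_small hδ h1.1.1 h1.1.2
    refine ⟨fun A => (hA A).trans ?_, P.lookahead, rfl, fun A => (hA A).trans ?_⟩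
    · have h3 : P.ε₂ * (1 / 2 + δ) ≤ δ := ((lt_div_iff₀ (by positivity)).mp h2.2).le
      calc (1 + δ) * P.meanLow ≤ (1 / 2 + δ) * (2 - P.ε₂) * P.meanLow :=
            mul_le_mul_of_nonneg_right (by linarith) P.meanLow_pos.le
        _ = (1 / 2 + δ) * ((2 - P.ε₂) * P.meanLow) := mul_assoc _ _ _
        _ ≤ _ := mul_le_mul_of_nonneg_left P.le_opt (by positivity)
    · exact mul_le_mul_of_nonneg_left P.meanLow_le_rev_lookahead (by positivity)
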